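/- Let $(G,+)$ be an abelian group, and let $p(G)$ be the smallest cardinality of a non-zero subgroup of $G$ (so $p(G)=\infty$ if $G$ has no finite non-zero subgroup). A matroid over $G$ is a matroid $M$ whose ground set $E(M)$ is a finite subset of $G$. A matroid of rank $n$ is paving if every $(n-1)$-subset of its ground set is independent, and it is sparse paving if it and its dual are both paving. If $M$ and $N$ are matroids over $G$ of the same rank $n$, then $M$ is matched to $N$ if for every basis $\mathcal M$ of $M$ there are a basis $\mathcal N$ of $N$ and a bijection $f:\mathcal M\to\mathcal N$ such that $a+f(a)\notin E(M)$ for all $a\in\mathcal M$. A progression is a subset of $G$ of the form $\{a,a+x,\dots,a+(k-1)x\}$ with $a,x\in G$ and an integer $k\ge 1$; a set $A\subset G$ is a semi-progression if $A\setminus\{a\}$ is a progression for some $a\in A$. **Theorem.** Let $M$ be any matroid over $G$ and let $N$ be a loopless sparse paving matroid over $G$, both of the same rank $n$, with $0\notin E(N)$. Assume that at least one of the following conditions holds: 1. $|E(M)|<\min\{|E(N)|-1,\,p(G)\}$; 2. $G$ is finite, $E(M)$ is not a progression, $|E(M)|=|E(N)|-1$ and $|E(N)|<p(G)$; 3. $G$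 is finite, $E(M)$ is neither a progression nor a semi-progression, and $|E(M)|=|E(N)|<p(G)$; 4. $|E(M)|<|E(N)|-n-1$. Then $M$ is matched to $N$. -/

import Mathlib

/-- `p(G)`: the smallest cardinality of a non-zero subgroup of `G`, as an extended natural number.
It is `⊤` if `G` has no finite non-zero subgroup. -/
noncomputable def minSubgroupCard (G : Type*) [AddCommGroup G] : ℕ∞ :=
  sInf {c : ℕ∞ | ∃ H : AddSubgroup G, H ≠ ⊥ ∧ c = ENat.card H}

/-- `A` is a progression: `A = {a, a + x, ..., a + (k - 1) x}` for some positive integer `k`. -/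
def IsProgression {G : Type*} [AddCommGroup G] (A : Set G) : Prop :=
  ∃ (a x : G) (k : ℕ), 0 < k ∧ A = {y : G | ∃ i : ℕ, i < k ∧ y = a + i • x}

/-- `A` is a semi-progression: removing one of its elements leaves a progression. -/
def IsSemiProgression {G : Type*} [AddCommGroup G] (A : Set G) : Prop :=
  ∃ a ∈ A, IsProgression (A \ {a})

namespace Matroid

/-- A matroid of rank `n` is paving if every `(n - 1)`-subset of its ground set is independent. -/
def IsPaving {α : Type*} (M : Matroid α) : Prop :=
  ∀ X : Set α, X ⊆ M.E → X.encard + 1 = M.eRank → M.Indep X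

/-- A matroid is sparse paving if it and its dual are both paving. -/
def IsSparsePaving {α : Type*} (M : Matroid α) : Prop :=
  M.IsPaving ∧ M✶.IsPaving

/-- `A` (a basis of `M`) is matched to `B` (a basis of another matroid of the same rank): there is
a bijection `f` from `A` to `B` with `a + f a ∉ E(M)` for all `a ∈ A`. -/
def BasisMatchedTo {G : Type*} [AddCommGroup G] (M : Matroid G) (A B : Set G) : Prop :=
  ∃ f : A ≃ B, ∀ a : A, (a : G) + (f a : G) ∉ M.E

/-- `M` is matched to `N`: every basis of `M` is matched to some basis of `N`. -/
def MatchedTo {G : Type*} [AddCommGroup G] (M N : Matroid G) : Prop :=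
  ∀ A : Set G, M.IsBase A → ∃ B : Set G, N.IsBase B ∧ M.BasisMatchedTo A B

end Matroid

/-!
Fix a basis `A` of `M` and put `E = E(M)`, `F = E(N)`. Join `a ∈ A` to `b ∈ F` when `a + b ∉ E`.
For `S ⊆ A`, let `U` be the set of those `b ∈ F` that are joined to no element of `S`. Since
`S ⊆ E` and `0 ∉ F`, the sumset `S + (U ∪ {0})` is contained in `E`, and it has a summand with
`|U| + 1` elements; so a lower bound for sumsets is a lower bound for the number `|F| - |U|` of
neighbours of `S`. As long as `|E| < p(G)`, the Cauchy–Davenport theorem shows that `S` has at least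
`|F| - |E| + |S|` neighbours (`card_add_card_le_card_biUnion_matchable_add_card`).
When `|E| + n + 1 < |F|`, the trivial bound `|U| + 1 ≤ |E|` suffices.

By Hall's theorem, `A` has a matching into `F` with image `B`. If `A` has more than `n` neighbours,
one element of `B` can be exchanged for a further neighbour, and two `n`-sets that differ by one
exchange cannot both be non-bases of a sparse paving matroid
(`Matroid.IsSparsePaving.isBase_insert_or_isBase_insert`). This settles all cases except that of
`|E| = |F|` with exactly `n` neighbours of `A`. Then equality holds in the Cauchy–Davenport theorem
for `A + (U ∪ {0}) = E`. If `n ≤ 1`, then `B` is a basis because `N` is loopless; if `U = ∅`, then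
`B = F`. Otherwise the equality case (`isProgression_add_of_card_add_card_eq`, a weak form of
Vosper's theorem in arbitrary abelian groups) says that `E` is a progression, which is excluded.

The equality case is proved by induction on the second summand with Dyson's `e`-transform. Only the
*sumset* is claimed to be a progression; since the transform can only shrink the sumset and equality
persists, the sumset stays the same and no information about the summands has to be carried back.
-/

open Finset Pointwise

/-! ### Sumsets of size less than the smallest subgroup -/

section Sumsets

variable {G : Type*} [AddCommGroup G]

lemma minSubgroupCard_le_minOrder : minSubgroupCard G ≤ AddMonoid.minOrder G := by
  rw [AddMonoid.le_minOrder]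
  intro a ha ha'
  refine sInf_le ⟨AddSubgroup.zmultiples a, by simpa using ha, ?_⟩
  have : Finite (AddSubgroup.zmultiples a) := ha'.finite_zmultiples
  rw [ENat.card_eq_coe_natCard, Nat.card_zmultiples]

variable [DecidableEq G]

/-- The Cauchy–Davenport theorem for a sumset contained in a set with fewer than `p(G)` elements. -/
lemma card_add_card_le_of_add_subset {S T C : Finset G} (hS : S.Nonempty) (hT : T.Nonempty)
    (hST : S + T ⊆ C) (hC : (#C : ℕ∞) < minSubgroupCard G) : #S + #T ≤ #C + 1 := by
  have h1 : #(S + T) ≤ #C := card_le_card hST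
  have h2 : (#(S + T) : ℕ∞) < AddMonoid.minOrder G :=
    ((Nat.cast_le.2 h1).trans_lt hC).trans_le minSubgroupCard_le_minOrder
  have h3 := (min_le_iff.1 (cauchy_davenport_minOrder_add hS hT)).resolve_left h2.not_ge
  have h4 : #S + #T - 1 ≤ #(S + T) := by exact_mod_cast h3
  lia

/-- If translating `A` by `x` adds just one element `c`, then `A` is an arithmetic progression that
ends in `c - x`, so that its union with the translate is a progression as well. -/
lemma isProgression_add_pair {A : Finset G} {x : G} (hx : x ≠ 0) (hA : A.Nonempty)
    (h : #(A + {0, x}) = #A + 1) (hp : (#(A + {0, x}) : ℕ∞) < minSubgroupCard G) :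
    IsProgression (↑(A + {0, x}) : Set G) := by
  have hsub : A ⊆ A + {0, x} := fun a ha => by
    simpa using add_mem_add ha (mem_insert_self (0 : G) {x})
  have hmem : ∀ a ∈ A, a + x ∈ A + {0, x} := fun a ha => add_mem_add ha (by simp)
  obtain ⟨c, hc⟩ : ∃ c, (A + {0, x}) \ A = {c} := by
    rw [← card_eq_one, card_sdiff_of_subset hsub]; lia
  have hstep : ∀ a ∈ A, a + x ∉ A → a + x = c := fun a ha hax =>
    mem_singleton.1 (hc ▸ mem_sdiff.2 ⟨hmem a ha, hax⟩)
  -- The elements whose whole forward orbit stays in `A` form a set that is stable under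
  -- translation by `x`, which is impossible for a nonempty set of this size.
  have hexit : ∀ a ∈ A, ∃ k : ℕ, a + k • x ∉ A := by
    classical
    by_contra! hcon
    obtain ⟨a, ha, hk⟩ := hcon
    set A' := A.filter (fun b => ∀ k : ℕ, b + k • x ∈ A) with hA'
    have hne : A'.Nonempty := ⟨a, by simp [hA', ha, hk]⟩
    have hst : A' + {0, x} ⊆ A' := by
      intro y hy
      obtain ⟨b, hb, z, hz, rfl⟩ := mem_add.1 hy
      obtain rfl | rfl : z = 0 ∨ z = x := by simpa using hz
      · simpa using hb
      · have hb' := (mem_filter.1 hb).2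
        refine mem_filter.2 ⟨by simpa using hb' 1, fun k => ?_⟩
        have := hb' (k + 1)
        rwa [succ_nsmul', ← add_assoc] at this
    have hle : #A' ≤ #(A + {0, x}) := card_le_card ((filter_subset _ _).trans hsub)
    have := card_add_card_le_of_add_subset hne (by simp) hst
      ((Nat.cast_le.2 hle).trans_lt hp)
    rw [card_pair hx.symm] at this
    lia
  -- `d a` is the number of steps for which the orbit of `a` stays in `A`.
  have hd : ∀ a ∈ A, ∃ k : ℕ, a + (k + 1) • x = c ∧ ∀ j ≤ k, a + j • x ∈ A := by
    classical
    intro a ha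
    obtain ⟨k, hk⟩ : ∃ k, Nat.find (hexit a ha) = k + 1 := by
      refine Nat.exists_eq_succ_of_ne_zero fun h0 => ?_
      have := Nat.find_spec (hexit a ha)
      rw [h0] at this
      simp [ha] at this
    have hmin : ∀ j ≤ k, a + j • x ∈ A := fun j hj => by
      simpa using Nat.find_min (hexit a ha) (m := j) (by lia)
    refine ⟨k, ?_, hmin⟩
    have hspec := Nat.find_spec (hexit a ha)
    rw [hk, succ_nsmul, ← add_assoc] at hspec
    rw [succ_nsmul, ← add_assoc]
    exact hstep _ (hmin k le_rfl) hspec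
  choose! d hdc hdA using hd
  obtain ⟨a, ha, hmax⟩ := exists_max_image A d hA
  refine ⟨a, x, d a + 2, by lia, ?_⟩
  ext y
  simp only [Finset.mem_coe, Set.mem_ofPred_eq]
  constructor
  · intro hy
    by_cases hyA : y ∈ A
    · refine ⟨d a - d y, by lia, ?_⟩
      have h1 := hdc y hyA
      rw [← hdc a ha] at h1
      obtain ⟨m, hm⟩ := Nat.exists_eq_add_of_le (hmax y hyA)
      rw [hm, show d y + m + 1 = m + (d y + 1) by ring, add_nsmul x m, ← add_assoc] at h1
      rw [hm, Nat.add_sub_cancel_left]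
      exact add_right_cancel h1
    · have : y = c := mem_singleton.1 (hc ▸ mem_sdiff.2 ⟨hy, hyA⟩)
      exact ⟨d a + 1, by lia, by rw [this, hdc a ha]⟩
  · rintro ⟨i, hi, rfl⟩
    obtain hi | rfl : i ≤ d a ∨ i = d a + 1 := by lia
    · exact hsub (hdA a ha i hi)
    · rw [hdc a ha]
      exact (mem_sdiff.1 (hc ▸ mem_singleton_self c)).1

/-- The equality case of the Cauchy–Davenport theorem in an abelian group: a sumset of critical
size with fewer than `p(G)` elements and non-trivial summands is a progression. Up to translation,
`0 ∈ B` is no restriction. -/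
lemma isProgression_add_of_card_add_card_eq {A B : Finset G} (h0 : 0 ∈ B)
    (hA : 2 ≤ #A) (hB : 2 ≤ #B) (h : #A + #B = #(A + B) + 1)
    (hp : (#(A + B) : ℕ∞) < minSubgroupCard G) : IsProgression (↑(A + B) : Set G) := by
  induction hk : #B using Nat.strong_induction_on generalizing A B with
  | _ k ih =>
  subst hk
  have hAAB : A ⊆ A + B := fun a ha => by simpa using add_mem_add ha h0
  have hlt : ∀ C ⊆ A + B, (#C : ℕ∞) < minSubgroupCard G := fun C hC =>
    (Nat.cast_le.2 (card_le_card hC)).trans_lt hp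
  obtain hB2 | hB3 : #B = 2 ∨ 3 ≤ #B := by lia
  · obtain ⟨x, hx, rfl⟩ : ∃ x, x ≠ 0 ∧ B = {0, x} := by
      have h1 : #(B.erase 0) = 1 := by rw [card_erase_of_mem h0, hB2]
      obtain ⟨x, hx⟩ := card_eq_one.1 h1
      refine ⟨x, (mem_erase.1 (hx ▸ mem_singleton_self x)).1, ?_⟩
      rw [← hx, insert_erase h0]
    exact isProgression_add_pair hx (card_pos.1 (by lia)) (by lia) hp
  by_cases he : ∃ e ∈ A, 2 ≤ #(B.filter fun b => e + b ∈ A) ∧ #(B.filter fun b => e + b ∈ A) < #B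
  · -- The transform at `e` keeps the sum of the cardinalities and does not enlarge the sumset.
    obtain ⟨e, heA, he2, heB⟩ := he
    set B' := B.filter fun b => e + b ∈ A with hB'
    set A' := A ∪ B.image (e + ·) with hA'
    have hinj : Function.Injective (e + · : G → G) := add_right_injective e
    have hinter : A ∩ B.image (e + ·) = B'.image (e + ·) := by
      ext y
      simp only [hB', mem_inter, mem_image, mem_filter]
      constructor
      · rintro ⟨hy, b, hb, rfl⟩; exact ⟨b, ⟨hb, hy⟩, rfl⟩
      · rintro ⟨b, ⟨hb, hy⟩, rfl⟩; exact ⟨hy, b, hb, rfl⟩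
    have hcard : #A' + #B' = #A + #B := by
      have := card_union_add_card_inter A (B.image (e + ·))
      rwa [hinter, card_image_of_injective _ hinj, card_image_of_injective _ hinj] at this
    have hsub : A' + B' ⊆ A + B := by
      intro y hy
      obtain ⟨a, ha, b, hb, rfl⟩ := mem_add.1 hy
      obtain ⟨hbB, hbA⟩ := mem_filter.1 hb
      obtain ha | ha := mem_union.1 ha
      · exact add_mem_add ha hbB
      · obtain ⟨b', hb', rfl⟩ := mem_image.1 ha
        rw [add_right_comm]
        exact add_mem_add hbA hb'
    have hA'2 : 2 ≤ #A' := hA.trans (card_le_card subset_union_left)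
    have hcd := card_add_card_le_of_add_subset (card_pos.1 (by lia : 0 < #A'))
      (card_pos.1 (by lia : 0 < #B')) subset_rfl (hlt _ hsub)
    have heq : A' + B' = A + B := eq_of_subset_of_card_le hsub (by lia)
    rw [← heq]
    refine ih _ heB (by simp [hB', h0, heA]) hA'2 he2 (by rw [heq]; lia) (hlt _ hsub) rfl
  · -- Every `e ∈ A` has `e + B` inside `A`, or `e` as its only common element with `A`. The
    -- Cauchy–Davenport theorem, applied to both kinds, gives `#B ≤ 2`.
    exfalso
    push Not at he
    set X := A.filter fun e => ∀ b ∈ B, e + b ∈ A with hX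
    set Y := A.filter fun e => ¬ ∀ b ∈ B, e + b ∈ A with hY
    have hXY : #X + #Y = #A := card_filter_add_card_filter_not _
    have hYsub : Y + B.erase 0 ⊆ (A + B) \ A := by
      intro y hy
      obtain ⟨e, he', b, hb, rfl⟩ := mem_add.1 hy
      obtain ⟨heA, heB⟩ := mem_filter.1 he'
      obtain ⟨hb0, hbB⟩ := mem_erase.1 hb
      refine mem_sdiff.2 ⟨add_mem_add heA hbB, fun hebA => heB ?_⟩
      have h2 : 2 ≤ #(B.filter fun b => e + b ∈ A) := by
        rw [← card_pair hb0.symm]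
        refine card_le_card fun z hz => ?_
        obtain rfl | rfl : z = 0 ∨ z = b := by simpa using hz
        · simp [h0, heA]
        · simp [hbB, hebA]
      exact filter_eq_self.1 (eq_of_subset_of_card_le (filter_subset _ _) (he e heA h2))
    have hBe : #(B.erase 0) = #B - 1 := card_erase_of_mem h0
    have hdiff : #((A + B) \ A) = #(A + B) - #A := card_sdiff_of_subset hAAB
    have hY1 : #Y ≤ 1 := by
      obtain hYe | hYn := Y.eq_empty_or_nonempty
      · simp [hYe]
      have := card_add_card_le_of_add_subset hYn (card_pos.1 (by lia)) hYsub
        (hlt _ sdiff_subset)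
      lia
    have hXsub : X + B ⊆ A := by
      intro y hy
      obtain ⟨e, he', b, hb, rfl⟩ := mem_add.1 hy
      exact (mem_filter.1 he').2 b hb
    have := card_add_card_le_of_add_subset (card_pos.1 (by lia : 0 < #X)) ⟨0, h0⟩ hXsub
      (hlt _ hAAB)
    lia

end Sumsets

/-! ### Exchange in sparse paving matroids -/

namespace Matroid

variable {α : Type*} {N : Matroid α}

/-- Two distinct one-element extensions of an `(n - 1)`-set cannot both be dependent: otherwise both
new elements lie in its closure, while the union of the two extensions spans, as its complement is
independent in the dual. -/
lemma IsSparsePaving.isBase_insert_or_isBase_insert [N.Finite] (hN : N.IsSparsePaving) {X : Set α}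
    {b c : α} (hXE : X ⊆ N.E) (hb : b ∈ N.E) (hc : c ∈ N.E) (hbX : b ∉ X) (hcX : c ∉ X)
    (hbc : b ≠ c) (hX : X.encard + 1 = N.eRank) :
    N.IsBase (insert b X) ∨ N.IsBase (insert c X) := by
  have hXI : N.Indep X := hN.1 X hXE hX
  have hXfin : X.Finite := N.ground_finite.subset hXE
  have key : ∀ e ∈ N.E, e ∉ X → ¬ N.IsBase (insert e X) → e ∈ N.closure X := by
    intro e he heX hbase
    rw [hXI.mem_closure_iff_of_notMem heX, ← not_indep_iff (Set.insert_subset he hXE)]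
    intro hind
    refine hbase (hind.isBase_of_eRk_ge (hXfin.insert e) ?_)
    rw [hind.eRk_eq_encard, Set.encard_insert_of_notMem heX, hX]
  by_contra! hcon
  set Y := insert b (insert c X) with hY
  have hYE : Y ⊆ N.E := Set.insert_subset hb (Set.insert_subset hc hXE)
  have hYcl : Y ⊆ N.closure X :=
    Set.insert_subset (key b hb hbX hcon.1)
      (Set.insert_subset (key c hc hcX hcon.2) (N.subset_closure X hXE))
  have hYcard : Y.encard = N.eRank + 1 := by
    rw [hY, Set.encard_insert_of_notMem (by simp [hbc, hbX]), Set.encard_insert_of_notMem hcX, hX]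
  have hYspan : N.Spanning Y := by
    rw [spanning_iff_compl_coindep hYE, coindep_def]
    refine hN.2 _ Set.sdiff_subset ?_
    have h1 := Set.encard_sdiff_add_encard_of_subset hYE
    rw [hYcard, ← N.eRank_add_eRank_dual] at h1
    have h2 : (N.E \ Y).encard + 1 + N.eRank = N✶.eRank + N.eRank := by
      rw [add_assoc, add_comm 1, h1, add_comm]
    exact ENat.add_left_injective_of_ne_top (N.eRank_ne_top_iff.2 inferInstance) h2
  have h2 : N.eRank ≤ X.encard := by
    rw [← hYspan.eRk_eq, ← hXI.eRk_eq_encard, ← N.eRk_closure_eq X]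
    exact N.eRk_mono hYcl
  rw [← hX] at h2
  exact ((ENat.lt_add_one_iff hXfin.encard_lt_top.ne).2 le_rfl).not_ge h2

/-- If a set with as many elements as the rank of `N` has a matching into the family `t` and the
members of `t` have a larger union, then the image of some matching is a basis: at most one exchange
is needed. -/
lemma IsSparsePaving.exists_matching_isBase [DecidableEq α] [N.Finite] (hN : N.IsSparsePaving)
    {ι : Type*} [DecidableEq ι] {A : Finset ι} {t : ι → Finset α} {f : ι → α}
    (ht : ∀ a ∈ A, (t a : Set α) ⊆ N.E)
    (hf : Set.InjOn f A) (hft : ∀ a ∈ A, f a ∈ t a) (hA : N.eRank = #A)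
    (hlt : #A < #(A.biUnion t)) :
    ∃ g : ι → α, Set.InjOn g A ∧ (∀ a ∈ A, g a ∈ t a) ∧ N.IsBase (g '' A) := by
  obtain ⟨c, hc, hcf⟩ := exists_mem_notMem_of_card_lt_card (card_image_le.trans_lt hlt :
    #(A.image f) < _)
  obtain ⟨a, ha, hca⟩ := mem_biUnion.1 hc
  have hcf' : ∀ a' ∈ A, f a' ≠ c := by simpa using hcf
  set X : Set α := f '' (A.erase a) with hX
  have hfX : f a ∉ X := by
    rintro ⟨a', ha', h⟩
    obtain ⟨hne, ha'A⟩ := mem_erase.1 (mem_coe.1 ha')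
    exact hne (hf ha'A ha h)
  have hcX : c ∉ X := by
    rintro ⟨a', ha', h⟩
    exact hcf' a' (mem_of_mem_erase (mem_coe.1 ha')) h
  have hAins : (A : Set ι) = insert a ↑(A.erase a) := by
    rw [← coe_insert, insert_erase ha]
  have hbase := hN.isBase_insert_or_isBase_insert (X := X) (b := f a) (c := c)
    (by
      rintro _ ⟨a', ha', rfl⟩
      have := mem_of_mem_erase (mem_coe.1 ha')
      exact ht a' this (hft a' this))
    (ht a ha (hft a ha)) (ht a ha hca) hfX hcX (hcf' a ha)
    (by
      rw [hX, (hf.mono (coe_subset.2 (erase_subset a A))).encard_image,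
        Set.encard_coe_eq_coe_finsetCard, hA, ← card_erase_add_one ha]
      norm_cast)
  obtain hbase | hbase := hbase
  · refine ⟨f, hf, hft, ?_⟩
    rwa [hAins, Set.image_insert_eq]
  · have himg : Function.update f a c '' A = insert c X := by
      rw [hAins, Set.image_insert_eq, Function.update_self, hX]
      congr 1
      refine Set.image_congr fun a' ha' => Function.update_of_ne (ne_of_mem_erase ha') _ _
    refine ⟨Function.update f a c, ?_, ?_, by rwa [himg]⟩
    · rw [hAins, Set.injOn_insert (by simp), Function.update_self]
      have heq : Set.EqOn (Function.update f a c) f ↑(A.erase a) := fun a' ha' =>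
        Function.update_of_ne (ne_of_mem_erase (mem_coe.1 ha')) _ _
      rw [heq.injOn_iff, heq.image_eq]
      exact ⟨hf.mono (coe_subset.2 (erase_subset a A)), hcX⟩
    · intro a' ha'
      obtain rfl | hne := eq_or_ne a' a
      · simpa using hca
      · simpa [hne] using hft a' ha'

end Matroid

/-! ### Neighbours in the matching graph -/

section Neighbours

variable {G : Type*} [AddCommGroup G] [DecidableEq G] {E F S : Finset G}

/-- The elements `b` of `F` to which `a` may be matched, that is, those with `a + b ∉ E`. -/
def matchable (E F : Finset G) (a : G) : Finset G :=
  F.filter fun b => a + b ∉ E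

lemma biUnion_matchable_subset (E F S : Finset G) : S.biUnion (matchable E F) ⊆ F :=
  biUnion_subset.2 fun _ _ => filter_subset _ _

lemma add_insert_zero_sdiff_matchable_subset (hS : S ⊆ E) :
    S + insert 0 (F \ S.biUnion (matchable E F)) ⊆ E := by
  intro y hy
  obtain ⟨a, ha, b, hb, rfl⟩ := mem_add.1 hy
  obtain rfl | hb := mem_insert.1 hb
  · simpa using hS ha
  · by_contra hab
    obtain ⟨hbF, hbS⟩ := mem_sdiff.1 hb
    exact hbS (mem_biUnion.2 ⟨a, ha, mem_filter.2 ⟨hbF, hab⟩⟩)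

lemma card_insert_zero_sdiff_matchable (h0 : 0 ∉ F) :
    #(insert 0 (F \ S.biUnion (matchable E F))) + #(S.biUnion (matchable E F)) = #F + 1 := by
  rw [card_insert_of_notMem fun h => h0 (mem_sdiff.1 h).1, add_right_comm,
    card_sdiff_add_card_eq_card (biUnion_matchable_subset E F S)]

lemma card_add_card_le_card_biUnion_matchable_add_card (hSE : S ⊆ E) (hS : S.Nonempty)
    (h0 : 0 ∉ F) (hE : (#E : ℕ∞) < minSubgroupCard G) :
    #S + #F ≤ #(S.biUnion (matchable E F)) + #E := by
  have h1 := card_add_card_le_of_add_subset hS (insert_nonempty _ _)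
    (add_insert_zero_sdiff_matchable_subset (F := F) hSE) hE
  have h2 := card_insert_zero_sdiff_matchable (E := E) (S := S) h0
  lia

/-- A translate of the second summand lies in `E`; this bound needs no condition on subgroups. -/
lemma card_lt_card_biUnion_matchable_add_card (hSE : S ⊆ E) (hS : S.Nonempty) (h0 : 0 ∉ F) :
    #F < #(S.biUnion (matchable E F)) + #E := by
  have h1 := (card_le_card_add_left hS).trans
    (card_le_card (add_insert_zero_sdiff_matchable_subset (F := F) hSE))
  have h2 := card_insert_zero_sdiff_matchable (E := E) (S := S) h0
  lia

/-- If the Cauchy–Davenport bound for the number of neighbours of `S` is attained, then `E` is itself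
a sumset of critical size, hence a progression unless a summand is trivial. -/
lemma isProgression_of_card_biUnion_matchable_add_card_le (hSE : S ⊆ E) (hS : 2 ≤ #S) (h0 : 0 ∉ F)
    (hE : (#E : ℕ∞) < minSubgroupCard G) (hF : #(S.biUnion (matchable E F)) < #F)
    (hle : #(S.biUnion (matchable E F)) + #E ≤ #S + #F) : IsProgression (E : Set G) := by
  set V := insert 0 (F \ S.biUnion (matchable E F)) with hV
  have hsub : S + V ⊆ E := add_insert_zero_sdiff_matchable_subset hSE
  have hcard : #V + _ = #F + 1 := card_insert_zero_sdiff_matchable (E := E) (S := S) h0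
  have hlt : (#(S + V) : ℕ∞) < minSubgroupCard G :=
    (Nat.cast_le.2 (card_le_card hsub)).trans_lt hE
  have hcd := card_add_card_le_of_add_subset (card_pos.1 (by lia : 0 < #S))
    (card_pos.1 (by lia : 0 < #V)) subset_rfl hlt
  have heq : S + V = E := eq_of_subset_of_card_le hsub (by lia)
  rw [← heq]
  exact isProgression_add_of_card_add_card_eq (mem_insert_self _ _) hS (by lia)
    (by rw [heq] at hcd ⊢; lia) hlt

/-- Hall's marriage theorem for a family of finsets indexed by a finset. -/
lemma exists_injOn_mem_of_hall {ι α : Type*} [DecidableEq ι] [DecidableEq α] [Nonempty α]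
    {A : Finset ι} {t : ι → Finset α} (h : ∀ S ⊆ A, #S ≤ #(S.biUnion t)) :
    ∃ f : ι → α, Set.InjOn f A ∧ ∀ a ∈ A, f a ∈ t a := by
  obtain ⟨f, hf, hft⟩ := (all_card_le_biUnion_card_iff_exists_injective fun a : A => t a).1
    fun s => by
      have := h (s.map (Function.Embedding.subtype _)) fun a ha => by
        obtain ⟨b, -, rfl⟩ := mem_map.1 ha
        exact b.2
      rwa [card_map, map_eq_image, image_biUnion] at this
  refine ⟨fun a => if ha : a ∈ A then f ⟨a, ha⟩ else Classical.arbitrary α, ?_, ?_⟩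
  · intro a ha b hb hab
    have ha' : a ∈ A := ha
    have hb' : b ∈ A := hb
    simp only [ha', hb', dif_pos] at hab
    exact congrArg Subtype.val (hf hab)
  · intro a ha
    simpa [ha] using hft ⟨a, ha⟩

end Neighbours

/-! ### Matched matroids -/

theorem mainTheorem2 {G : Type*} [AddCommGroup G] (n : ℕ) (M N : Matroid G)
    [M.Finite] [N.Finite] [N.Loopless]
    (hM : M.eRank = n) (hN : N.eRank = n) (hsp : N.IsSparsePaving) (h0 : (0 : G) ∉ N.E)
    (h : (M.E.ncard + 1 < N.E.ncard ∧ (M.E.ncard : ℕ∞) < minSubgroupCard G) ∨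
      (Finite G ∧ ¬ IsProgression M.E ∧ M.E.ncard + 1 = N.E.ncard ∧
        (N.E.ncard : ℕ∞) < minSubgroupCard G) ∨
      (Finite G ∧ ¬ IsProgression M.E ∧ ¬ IsSemiProgression M.E ∧ M.E.ncard = N.E.ncard ∧
        (N.E.ncard : ℕ∞) < minSubgroupCard G) ∨
      M.E.ncard + n + 1 < N.E.ncard) :
    M.MatchedTo N := by
  classical
  intro A₀ hA₀
  obtain ⟨E, hE⟩ := M.ground_finite.exists_finset_coe
  obtain ⟨F, hF⟩ := N.ground_finite.exists_finset_coe
  obtain ⟨A, rfl⟩ := (M.ground_finite.subset hA₀.subset_ground).exists_finset_coe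
  have hAE : A ⊆ E := by rw [← coe_subset, hE]; exact hA₀.subset_ground
  have hAn : #A = n := by
    have := hA₀.encard_eq_eRank
    rw [hM, Set.encard_coe_eq_coe_finsetCard] at this
    exact_mod_cast this
  have hNA : N.eRank = #A := by rw [hN, hAn]
  simp only [← hE, ← hF, Set.ncard_coe_finset, mem_coe] at h h0
  have hFN : ∀ a, (matchable E F a : Set G) ⊆ N.E := fun a => by
    rw [← hF, coe_subset]
    exact filter_subset _ _
  -- It suffices to match `A` onto a basis inside the matching graph.
  suffices hg : ∃ g : G → G, Set.InjOn g A ∧ (∀ a ∈ A, g a ∈ matchable E F a) ∧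
      N.IsBase (g '' A) by
    obtain ⟨g, hg, hgm, hbase⟩ := hg
    refine ⟨g '' A, hbase, Equiv.Set.imageOfInjOn g A hg, fun a => ?_⟩
    rw [← hE]
    exact (mem_filter.1 (hgm a a.2)).2
  have hnb : ∀ S ⊆ A, S.Nonempty → #S ≤ #(S.biUnion (matchable E F)) ∧
      (#S < #(S.biUnion (matchable E F)) ∨
        #E = #F ∧ (#E : ℕ∞) < minSubgroupCard G ∧ ¬ IsProgression (E : Set G)) := by
    intro S hSA hS
    have hSE := hSA.trans hAE
    have hcd := card_add_card_le_card_biUnion_matchable_add_card hSE hS h0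
    obtain ⟨hlt, hp⟩ | ⟨-, -, hlt, hp⟩ | ⟨-, hprog, -, heq, hp⟩ | hlt := h
    · have := hcd hp
      lia
    · have := hcd ((Nat.cast_le.2 (by lia)).trans_lt hp)
      lia
    · have := hcd (by rwa [heq])
      exact ⟨by lia, Or.inr ⟨heq, by rwa [heq], hprog⟩⟩
    · have := card_lt_card_biUnion_matchable_add_card hSE hS h0
      have := card_le_card hSA
      lia
  obtain ⟨f, hf, hfm⟩ := exists_injOn_mem_of_hall (A := A) (t := matchable E F) fun S hS => by
    obtain rfl | hne := S.eq_empty_or_nonempty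
    · simp
    · exact (hnb S hS hne).1
  by_cases hlt : #A < #(A.biUnion (matchable E F))
  · exact hsp.exists_matching_isBase (fun a _ => hFN a) hf hfm hNA hlt
  refine ⟨f, hf, hfm, ?_⟩
  have hfF : f '' A ⊆ N.E := by
    rintro _ ⟨a, ha, rfl⟩
    exact hFN a (hfm a ha)
  have hcard : (f '' (A : Set G)).encard = N.eRank := by
    rw [hf.encard_image, Set.encard_coe_eq_coe_finsetCard, hNA]
  have hbase : N.Indep (f '' A) → N.IsBase (f '' A) := fun hind =>
    hind.isBase_of_eRk_ge (A.finite_toSet.image f) (by rw [hind.eRk_eq_encard, hcard])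
  obtain hA1 | hA2 : #A ≤ 1 ∨ 2 ≤ #A := by lia
  · have hA : (A : Set G).Subsingleton := fun a ha b hb => card_le_one.1 hA1 a ha b hb
    exact hbase (N.subsingleton_indep (hA.image f) hfF)
  obtain ⟨-, hor⟩ := hnb A subset_rfl (card_pos.1 (by lia))
  obtain ⟨hEF, hp, hprog⟩ := hor.resolve_left hlt
  by_cases hU : #(A.biUnion (matchable E F)) < #F
  · exact absurd (isProgression_of_card_biUnion_matchable_add_card_le hAE hA2 h0 hp hU (by lia))
      hprog
  -- Here `N` has only `n` elements, so its ground set is its only basis.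
  obtain ⟨B, hB⟩ := N.exists_isBase
  have hfin : (N.E).encard ≤ N.eRank := by
    rw [hNA, ← hF, Set.encard_coe_eq_coe_finsetCard]
    exact_mod_cast by lia
  have h1 : f '' A = N.E :=
    (N.ground_finite.subset hfF).eq_of_subset_of_encard_le hfF (by rwa [hcard])
  have h2 : B = N.E := (N.ground_finite.subset hB.subset_ground).eq_of_subset_of_encard_le
    hB.subset_ground (by rwa [hB.encard_eq_eRank])
  rw [h1, ← h2]
  exact hB
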